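/- Let $d\ge 1$ and let $\mathcal H$ be a $d$-dimensional complex Hilbert space. A POVM on a finite-dimensional Hilbert space is a finite family of positive semidefinite operators summing to the identity; it is simple if its elements are pairwise linearly independent. For POVMs $\mathscr A=\{A_j\}_j$ and $\mathscr B=\{B_k\}_k$ on $\mathcal H$, $\mathscr A\otimes\mathscr B$ denotes the POVM $\{A_j\otimes B_k\}_{j,k}$ on $\mathcal H^{\otimes 2}$. They are mutually unbiased if $\operatorname{tr}(A_jB_k)=\operatorname{tr}(A_j)\operatorname{tr}(B_k)/d$ for all $j,k$; a POVM is a rank-1 projective measurement if its elements are mutually orthogonal rank-1 projectors. The two-copy estimation fidelity of a POVM $\mathscr M=\{M_j\}_j$ on $\mathcal H^{\otimes 2}$ is the maximal average fidelity $$F(\mathscr M)=\max_{\{\hat\rho_j\}}\sum_j\int d\mu(\psi)\,\operatorname{tr}\bigl(\rho^{\otimes 2}M_j\bigr)\operatorname{tr}(\rho\hat\rho_j),\qquad \rho=|\psi\rangle\langle\psi|,$$ where $\mu$ is the distribution of Haar random pure states on $\mathcal H$ and the maximum is over all families of density operators $\hat\rho_j$ on $\mathcal H$. Suppose $\mathscr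 A$ and $\mathscr B$ are two simple POVMs on $\mathcal H$. Then $\mathscr A$ and $\mathscr B$ are mutually unbiased rank-1 projective measurements if and only if $$F(\mathscr A\otimes\mathscr B)=\frac{2(d+1+\sqrt d)}{(d+1)(d+2)}\quad\text{and}\quad F(\mathscr A\otimes\mathscr A)=F(\mathscr B\otimes\mathscr B)=\frac{2}{d+1}.$$ -/

import Mathlib

open MeasureTheory Matrix
open scoped Kronecker ComplexOrder

noncomputable section

/-! ### Measurements on a finite-dimensional Hilbert space `ℂ^n`

Operators on the Hilbert space with orthonormal basis indexed by `n` are matrices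
`Matrix n n ℂ`; the tensor product of two such spaces is indexed by the product type, and the
tensor product of operators is the Kronecker product. -/

/-- A POVM with outcomes `ι`: positive (semidefinite) operators that sum up to the identity. -/
structure POVM (n : Type*) [Fintype n] [DecidableEq n] (ι : Type*) [Fintype ι] where
  /-- the POVM elements -/
  elem : ι → Matrix n n ℂ
  posSemidef : ∀ j, (elem j).PosSemidef
  sum_elem : ∑ j, elem j = 1

namespace POVM

/-- A POVM is simple if its elements are pairwise linearly independent. -/
def IsSimple {n ι : Type*} [Fintype n] [DecidableEq n] [Fintype ι] (A : POVM n ι) : Prop :=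
  ∀ i j, i ≠ j → LinearIndependent ℂ ![A.elem i, A.elem j]

/-- A rank-1 projective measurement: the elements are mutually orthogonal rank-1 projectors. -/
def IsRankOneProjective {n ι : Type*} [Fintype n] [DecidableEq n] [Fintype ι]
    (A : POVM n ι) : Prop :=
  (∀ j, IsStarProjection (A.elem j) ∧ (A.elem j).rank = 1) ∧
    ∀ i j, i ≠ j → A.elem i * A.elem j = 0

/-- Two POVMs are mutually unbiased if `tr (A_j B_k) = tr A_j * tr B_k / d` for all `j`, `k`,
where `d` is the dimension of the Hilbert space. -/
def IsMutuallyUnbiased {n ι κ : Type*} [Fintype n] [DecidableEq n] [Fintype ι] [Fintype κ]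
    (A : POVM n ι) (B : POVM n κ) : Prop :=
  ∀ j k, (A.elem j * B.elem k).trace =
    (A.elem j).trace * (B.elem k).trace / (Fintype.card n : ℂ)

/-- The product POVM `A ⊗ B = {A_j ⊗ B_k}_{j,k}`. -/
def tensor {m n ι κ : Type*} [Fintype m] [DecidableEq m] [Fintype n] [DecidableEq n]
    [Fintype ι] [Fintype κ] (A : POVM m ι) (B : POVM n κ) : POVM (m × n) (ι × κ) where
  elem p := A.elem p.1 ⊗ₖ B.elem p.2
  posSemidef p := (A.posSemidef p.1).kronecker (B.posSemidef p.2)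
  sum_elem := by
    rw [← one_kronecker_one (α := ℂ), ← A.sum_elem, ← B.sum_elem, Fintype.sum_prod_type]
    ext x y
    simp [Matrix.sum_apply, kroneckerMap_apply, Finset.sum_mul_sum]

end POVM

/-! ### Haar random pure states -/

instance (d : ℕ) : CompactSpace (unitaryGroup (Fin d) ℂ) := by
  have hcont : Continuous fun A : Matrix (Fin d) (Fin d) ℂ => A * star A :=
    continuous_id.matrix_mul continuous_id.matrix_conjTranspose
  have hcl : IsClosed (unitaryGroup (Fin d) ℂ : Set (Matrix (Fin d) (Fin d) ℂ)) := by
    have h : (unitaryGroup (Fin d) ℂ : Set (Matrix (Fin d) (Fin d) ℂ)) =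
        (fun A : Matrix (Fin d) (Fin d) ℂ => A * star A) ⁻¹' {1} := by
      ext A
      exact mem_unitaryGroup_iff
    rw [h]
    exact isClosed_singleton.preimage hcont
  have hK : IsCompact (Set.univ.pi fun _ : Fin d =>
      Set.univ.pi fun _ : Fin d => Metric.closedBall (0 : ℂ) 1) :=
    isCompact_univ_pi fun _ => isCompact_univ_pi fun _ => isCompact_closedBall _ _
  exact isCompact_iff_compactSpace.mp <| hK.of_isClosed_subset hcl fun U hU i _ j _ => by
    simpa using entry_norm_bound_of_unitary hU i j

/-- The unitary group carries its Borel σ-algebra. -/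
instance (d : ℕ) : MeasurableSpace (unitaryGroup (Fin d) ℂ) := borel _

instance (d : ℕ) : BorelSpace (unitaryGroup (Fin d) ℂ) := ⟨rfl⟩

/-- The normalized Haar measure on the unitary group `U(d)`. -/
def haarUnitary (d : ℕ) : Measure (unitaryGroup (Fin d) ℂ) := Measure.haarMeasure ⊤

/-- The pure state `|ψ⟩⟨ψ|` with `|ψ⟩ = U |0⟩`; for a Haar random unitary `U` this is a
Haar random pure state. -/
def pureState {d : ℕ} [NeZero d] (U : unitaryGroup (Fin d) ℂ) : Matrix (Fin d) (Fin d) ℂ :=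
  let ψ : Fin d → ℂ := U.1 *ᵥ Pi.single 0 1
  vecMulVec ψ (star ψ)

/-! ### The estimation fidelity -/

/-- Quantum states: positive semidefinite matrices of trace `1`. -/
def DensityMatrix (n : Type*) [Fintype n] : Type _ :=
  {ρ : Matrix n n ℂ // ρ.PosSemidef ∧ ρ.trace = 1}

/-- The average fidelity `∑_j ∫ dμ(ψ) tr (ρ^{⊗2} M_j) tr (ρ ρ̂_j)`, `ρ = |ψ⟩⟨ψ|`, when a
POVM `M` is performed on two copies of a Haar random pure state `ρ`, and the estimate `ρ̂_j` is
reported on outcome `j`. -/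
def averageFidelity {d : ℕ} [NeZero d] {ι : Type*} [Fintype ι] (M : POVM (Fin d × Fin d) ι)
    (est : ι → DensityMatrix (Fin d)) : ℝ :=
  ∑ j, ∫ U, (((pureState U ⊗ₖ pureState U) * M.elem j).trace).re *
    ((pureState U * (est j).1).trace).re ∂(haarUnitary d)

/-- The two-copy estimation fidelity `F(M)`: the maximal average fidelity over all choices of
the estimators. -/
def estimationFidelity {d : ℕ} [NeZero d] {ι : Type*} [Fintype ι]
    (M : POVM (Fin d × Fin d) ι) : ℝ :=
  ⨆ est : ι → DensityMatrix (Fin d), averageFidelity M est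

/-- `F₂^sep = 2 (d + 1 + √d) / ((d + 1) (d + 2))`. -/
def fidelitySep (d : ℕ) : ℝ :=
  2 * ((d : ℝ) + 1 + √(d : ℝ)) / (((d : ℝ) + 1) * ((d : ℝ) + 2))

end

/-!
Haar invariance annihilates the integral of the derivative of `tr(ρA) tr(ρB) tr(ρC)` along every
commutator direction `⁅X, ρ⁆`. Summed over the matrix units `X`, this is a recursion for the third
moments of a random pure state `ρ`. Hence the fidelity of `A ⊗ B` is, up to normalization, the sum
over the outcomes of the largest eigenvalue of an explicit operator `Q(A_j, B_k)`. On rank-one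
operators `|a⟩⟨a|`, `|b⟩⟨b|` this eigenvalue is `N² + s² + (N + s)²` with `N = ‖a‖ ‖b‖` and
`s = |⟨a|b⟩|`.

Since `2 N s ≤ c N² + c⁻¹ s²`, with equality iff `s = c N`, the eigenvalue is at most
`(2 + c) N² + (2 + c⁻¹) s²`, whose bilinear extension `(2 + c) tr A tr B + (2 + c⁻¹) tr (AB)` bounds
`Q(A, B)` for all positive `A` and `B`. Its sum over the outcomes is fixed by the normalization of
the measurements and, for `c = 1 / √d`, equals the fidelity in the theorem. So that fidelity forces
equality throughout, and equality forces all elements to have rank one and all overlaps to be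
unbiased. For `A ⊗ A` with rank-one elements, fidelity `2 / (d + 1)` says `∑ s (N - s) = 0`, so
that any two elements are orthogonal or proportional, and the latter is excluded by simplicity.
-/

open scoped InnerProductSpace

/-! ### Rank-one operators -/

section Ketbra

variable {n : Type*}

/-- The rank-one operator `|a⟩⟨a|`, for a vector `a` that need not be normalized. -/
def ketbra (a : EuclideanSpace ℂ n) : Matrix n n ℂ :=
  vecMulVec a.ofLp (star a.ofLp)

theorem ketbra_zero : ketbra (0 : EuclideanSpace ℂ n) = 0 :=
  zero_vecMulVec _

theorem ketbra_smul (r : ℂ) (a : EuclideanSpace ℂ n) :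
    ketbra (r • a) = ((‖r‖ ^ 2 : ℝ) : ℂ) • ketbra a := by
  rw [ketbra, ketbra, WithLp.ofLp_smul, star_smul, vecMulVec_smul, smul_vecMulVec, smul_smul,
    Complex.ofReal_pow, ← Complex.conj_mul', Complex.star_def]

theorem continuous_ketbra : Continuous (ketbra : EuclideanSpace ℂ n → Matrix n n ℂ) := by
  have h : Continuous fun a : EuclideanSpace ℂ n => a.ofLp := PiLp.continuous_ofLp 2 _
  exact h.matrix_vecMulVec h.star

theorem sum_ketbra_smul {ι : Type*} [Fintype ι] (μ : ι → ℂ) (z : EuclideanSpace ℂ n) :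
    ∑ i, ketbra (μ i • z) = ketbra (((√(∑ i, ‖μ i‖ ^ 2) : ℝ) : ℂ) • z) := by
  have hμ : 0 ≤ ∑ i, ‖μ i‖ ^ 2 := by positivity
  rw [ketbra_smul, Complex.norm_real, Real.norm_of_nonneg (Real.sqrt_nonneg _), Real.sq_sqrt hμ,
    Complex.ofReal_sum, Finset.sum_smul]
  exact Finset.sum_congr rfl fun i _ => ketbra_smul _ _

theorem posSemidef_ketbra [Finite n] (a : EuclideanSpace ℂ n) : (ketbra a).PosSemidef :=
  posSemidef_vecMulVec_self_star _

theorem exists_eq_sum_ketbra [Finite n] {A : Matrix n n ℂ} (hA : A.PosSemidef) :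
    ∃ (m : ℕ) (a : Fin m → EuclideanSpace ℂ n), A = ∑ i, ketbra (a i) := by
  have := Fintype.ofFinite n
  obtain ⟨m, v, rfl⟩ := posSemidef_iff_eq_sum_vecMulVec.mp hA
  exact ⟨m, fun i => WithLp.toLp 2 (v i), rfl⟩

variable [Fintype n]

theorem trace_ketbra (a : EuclideanSpace ℂ n) : (ketbra a).trace = ((‖a‖ ^ 2 : ℝ) : ℂ) := by
  rw [ketbra, trace_vecMulVec, ← EuclideanSpace.inner_eq_star_dotProduct,
    inner_self_eq_norm_sq_to_K, Complex.ofReal_pow, RCLike.ofReal_eq_complex_ofReal]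

theorem rank_ketbra {a : EuclideanSpace ℂ n} (ha : a ≠ 0) : (ketbra a).rank = 1 := by
  refine le_antisymm (rank_vecMulVec_le _ _) (Nat.one_le_iff_ne_zero.mpr fun hrank => ha ?_)
  classical
  have hzero : ketbra a = 0 := toLin'.injective <| by
    rw [map_zero]
    exact LinearMap.range_eq_bot.mp (Submodule.finrank_eq_zero.mp hrank)
  have htrace := congrArg trace hzero
  rw [trace_ketbra, trace_zero] at htrace
  simpa using htrace

theorem ketbra_mul_ketbra (a b : EuclideanSpace ℂ n) :
    ketbra a * ketbra b = ⟪a, b⟫_ℂ • vecMulVec a.ofLp (star b.ofLp) := by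
  rw [ketbra, ketbra, vecMulVec_mul_vecMulVec, vecMulVec_smul, dotProduct_comm,
    EuclideanSpace.inner_eq_star_dotProduct]

theorem trace_ketbra_mul_ketbra (a b : EuclideanSpace ℂ n) :
    (ketbra a * ketbra b).trace = ((‖⟪a, b⟫_ℂ‖ ^ 2 : ℝ) : ℂ) := by
  rw [ketbra_mul_ketbra, trace_smul, trace_vecMulVec, ← EuclideanSpace.inner_eq_star_dotProduct,
    smul_eq_mul, ← inner_conj_symm b a, Complex.mul_conj', Complex.ofReal_pow]

theorem trace_ketbra_mul_ketbra_mul_ketbra (a b v : EuclideanSpace ℂ n) :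
    (ketbra a * ketbra b * ketbra v).trace = ⟪v, a⟫_ℂ * ⟪a, b⟫_ℂ * ⟪b, v⟫_ℂ := by
  rw [ketbra_mul_ketbra, smul_mul, ketbra, vecMulVec_mul_vecMulVec, vecMulVec_smul, trace_smul,
    trace_smul, trace_vecMulVec, dotProduct_comm (star _),
    ← EuclideanSpace.inner_eq_star_dotProduct, ← EuclideanSpace.inner_eq_star_dotProduct,
    smul_eq_mul, smul_eq_mul]
  ring

theorem ketbra_mul_mul_ketbra (a : EuclideanSpace ℂ n) (M : Matrix n n ℂ) :
    ketbra a * M * ketbra a = (ketbra a * M).trace • ketbra a := by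
  rw [ketbra, vecMulVec_mul, vecMulVec_mul_vecMulVec, trace_vecMulVec, dotProduct_comm,
    vecMulVec_smul]

theorem exists_eq_ketbra_of_isStarProjection {P : Matrix n n ℂ}
    (hP : IsStarProjection P) (hr : P.rank = 1) :
    ∃ a : EuclideanSpace ℂ n, ‖a‖ = 1 ∧ P = ketbra a := by
  classical
  set p := toEuclideanCLM (n := n) (𝕜 := ℂ) P
  obtain ⟨_, hproj⟩ := isStarProjection_iff_eq_starProjection_range.mp
    (show IsStarProjection p from hP.map (toEuclideanCLM (n := n) (𝕜 := ℂ)))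
  have hrank : Module.finrank ℂ p.range = 1 := by
    rw [← hr, P.rank_eq_finrank_range_toLin (EuclideanSpace.basisFun n ℂ).toBasis
      (EuclideanSpace.basisFun n ℂ).toBasis, ← toEuclideanLin_eq_toLin_orthonormal]
    rfl
  let b := (stdOrthonormalBasis ℂ p.range).reindex (finCongr hrank)
  refine ⟨b 0, (Submodule.norm_coe _).trans (b.norm_eq_one 0), ?_⟩
  rw [b.starProjection_eq_sum_rankOne, Fin.sum_univ_one] at hproj
  rw [ketbra, ← InnerProductSpace.symm_toEuclideanLin_rankOne, LinearEquiv.eq_symm_apply, ← hproj]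
  rfl

end Ketbra

/-! ### Third moments of Haar random pure states -/

theorem integrable_of_continuous {X E : Type*} [TopologicalSpace X] [CompactSpace X]
    [MeasurableSpace X] [OpensMeasurableSpace X] [NormedAddCommGroup E] {μ : Measure X}
    [IsFiniteMeasure μ] {f : X → E} (hf : Continuous f) : Integrable f μ :=
  hf.integrable_of_hasCompactSupport (HasCompactSupport.of_compactSpace f)

theorem integral_eq_zero_of_hasDerivAt_mul_left {G E : Type*} [Group G] [TopologicalSpace G]
    [ContinuousMul G] [CompactSpace G] [MeasurableSpace G] [BorelSpace G] [NormedAddCommGroup E]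
    [NormedSpace ℝ E] {μ : Measure G} [IsFiniteMeasure μ] [μ.IsMulLeftInvariant] {γ : ℝ → G}
    (hγ : γ 0 = 1) {Φ Ψ : G → E} (hΦ : Continuous Φ) (hΨ : Continuous Ψ)
    (hderiv : ∀ g t, HasDerivAt (fun s => Φ (γ s * g)) (Ψ (γ t * g)) t) :
    ∫ g, Ψ g ∂μ = 0 := by
  have translate {f : G → E} (hf : Continuous f) (t : ℝ) : Integrable (fun g => f (γ t * g)) μ :=
    integrable_of_continuous (hf.comp (continuous_const_mul (γ t)))
  obtain ⟨K, hK⟩ := isCompact_univ.exists_bound_of_continuousOn hΨ.continuousOn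
  have hasDerivAt_integral := (hasDerivAt_integral_of_dominated_loc_of_deriv_le (μ := μ)
    (F' := fun t g => Ψ (γ t * g)) (x₀ := (0 : ℝ)) (bound := fun _ => K) Filter.univ_mem
    (.of_forall fun t => (translate hΦ t).aestronglyMeasurable) (translate hΦ 0)
    (translate hΨ 0).aestronglyMeasurable (.of_forall fun g t _ => hK _ (Set.mem_univ _))
    (integrable_const K) (.of_forall fun g t _ => hderiv g t)).2
  simp only [integral_mul_left_eq_self Φ, hγ, one_mul] at hasDerivAt_integral
  exact hasDerivAt_integral.unique (hasDerivAt_const _ _)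

theorem trace_lie_mul {n R : Type*} [Fintype n] [CommRing R] (A B C : Matrix n n R) :
    (⁅A, B⁆ * C).trace = (A * ⁅B, C⁆).trace := by
  rw [Ring.lie_def, Ring.lie_def, sub_mul, mul_sub, trace_sub, trace_sub, mul_assoc, mul_assoc,
    trace_mul_comm B, mul_assoc]

open scoped Matrix.Norms.L2Operator in
theorem exists_unitaryGroup_flow {n : Type*} [Fintype n] [DecidableEq n]
    {H : Matrix n n ℂ} (hH : IsSelfAdjoint H) :
    ∃ γ : ℝ → unitaryGroup n ℂ, γ 0 = 1 ∧ ∀ (ρ A : Matrix n n ℂ) (t : ℝ),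
      HasDerivAt (fun s => ((γ s).1 * ρ * star (γ s).1 * A).trace)
        (Complex.I * (H * ⁅(γ t).1 * ρ * star (γ t).1, A⁆).trace) t := by
  let γ (s : ℝ) : unitaryGroup n ℂ := selfAdjoint.expUnitary (s • ⟨H, hH⟩)
  have hγ (t : ℝ) : HasDerivAt (fun s => (γ s).1) (Complex.I • H * (γ t).1) t := by
    have hexp (s : ℝ) : (γ s).1 = NormedSpace.exp (s • (Complex.I • H)) := by
      rw [smul_comm]
      rfl
    simp only [hexp]
    exact hasDerivAt_exp_smul_const' _ t
  have hconj (V ρ : Matrix n n ℂ) : Complex.I • H * V * ρ * star V +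
      V * ρ * star (Complex.I • H * V) = Complex.I • ⁅H, V * ρ * star V⁆ := by
    rw [star_mul, star_smul, hH.star_eq, Complex.star_def, Complex.conj_I, neg_smul, mul_neg,
      mul_neg, ← sub_eq_add_neg, mul_smul_comm, mul_smul_comm, smul_mul_assoc, smul_mul_assoc,
      smul_mul_assoc, ← smul_sub, Ring.lie_def]
    simp only [mul_assoc]
  refine ⟨γ, by simp [γ], fun ρ A t => ?_⟩
  have htrace := (traceLinearMap n ℝ ℂ).toContinuousLinearMap.hasFDerivAt.comp_hasDerivAt t
    ((((hγ t).mul_const ρ).mul (hγ t).star).mul_const A)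
  refine htrace.congr_deriv ?_
  rw [hconj, LinearMap.coe_toContinuousLinearMap', traceLinearMap_apply, smul_mul_assoc,
    trace_smul, trace_lie_mul, smul_eq_mul]

section Moments

/-- The derivative of `tr(ρA) tr(ρB) tr(ρC)` along `⁅X, ρ⁆` is
`tr (X * commutatorGradient A B C ρ)`, as `tr (⁅X, ρ⁆ A) = tr (X ⁅ρ, A⁆)`. -/
def commutatorGradient {n : Type*} [Fintype n] (A B C ρ : Matrix n n ℂ) : Matrix n n ℂ :=
  ((ρ * B).trace * (ρ * C).trace) • ⁅ρ, A⁆ + ((ρ * A).trace * (ρ * C).trace) • ⁅ρ, B⁆ +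
    ((ρ * A).trace * (ρ * B).trace) • ⁅ρ, C⁆

section MatrixUnits

variable {n : Type*} [Fintype n] [DecidableEq n]

theorem sum_single_mul_mul_single (M : Matrix n n ℂ) :
    ∑ k, ∑ l, single k l 1 * M * single l k 1 = M.trace • (1 : Matrix n n ℂ) := by
  simp only [single_mul_mul_single, one_mul, mul_one]
  rw [Finset.sum_comm]
  simp only [sum_single_eq_diagonal, ← smul_one_eq_diagonal, ← Finset.sum_smul]
  rfl

theorem sum_trace_single_mul_trace_single_mul (M N : Matrix n n ℂ) :
    ∑ k, ∑ l, (single k l 1 * M).trace * (single l k 1 * N).trace = (M * N).trace := by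
  simp only [trace_single_mul, smul_eq_mul, one_mul]
  exact Finset.sum_comm

theorem sum_trace_single_mul_lie_single_mul (ρ A : Matrix n n ℂ) :
    ∑ k, ∑ l, (single k l 1 * ⁅ρ, single l k 1 * A⁆).trace =
      ρ.trace * A.trace - Fintype.card n * (ρ * A).trace := by
  have expand (k l : n) : single k l 1 * ⁅ρ, single l k 1 * A⁆ =
      single k l 1 * ρ * single l k 1 * A - single k l 1 * 1 * single l k 1 * (A * ρ) := by
    rw [Ring.lie_def, mul_sub, mul_one]
    simp only [mul_assoc]
  simp only [expand, ← trace_sum, Finset.sum_sub_distrib, ← Finset.sum_mul]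
  rw [sum_single_mul_mul_single, sum_single_mul_mul_single, trace_one, smul_one_mul, smul_one_mul,
    trace_sub, trace_smul, trace_smul, trace_mul_comm A, smul_eq_mul, smul_eq_mul]

theorem sum_trace_mul_single_mul_mul_trace_single_mul (M A B : Matrix n n ℂ) :
    ∑ k, ∑ l, (M * (single l k 1 * A)).trace * (single k l 1 * B).trace = (B * (A * M)).trace := by
  simp_rw [← sum_trace_single_mul_trace_single_mul B, trace_mul_comm M, mul_assoc, mul_comm]

theorem sum_trace_single_mul_commutatorGradient {ρ : Matrix n n ℂ} (hρ : ρ.trace = 1)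
    (hmul : ∀ M, ρ * M * ρ = (ρ * M).trace • ρ) (A B C : Matrix n n ℂ) :
    ∑ k, ∑ l, (single k l 1 * commutatorGradient (single l k 1 * A) B C ρ).trace =
      A.trace * ((ρ * B).trace * (ρ * C).trace) + (ρ * (B * A)).trace * (ρ * C).trace +
        (ρ * (C * A)).trace * (ρ * B).trace -
        (Fintype.card n + 2) * ((ρ * A).trace * (ρ * B).trace * (ρ * C).trace) := by
  have mixed (M : Matrix n n ℂ) :
      ∑ k, ∑ l, (ρ * (single l k 1 * A)).trace * (single k l 1 * ⁅ρ, M⁆).trace =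
        (ρ * (M * A)).trace - (ρ * A).trace * (ρ * M).trace := by
    rw [sum_trace_mul_single_mul_mul_trace_single_mul, Ring.lie_def, sub_mul, trace_sub,
      show ρ * M * (A * ρ) = ρ * (M * A) * ρ by simp only [mul_assoc], hmul,
      show M * ρ * (A * ρ) = M * (ρ * A * ρ) by simp only [mul_assoc], hmul,
      Matrix.mul_smul, trace_smul, trace_smul, hρ, smul_eq_mul, smul_eq_mul, mul_one,
      trace_mul_comm M]
  have expand (k l : n) :
      (single k l 1 * commutatorGradient (single l k 1 * A) B C ρ).trace =
        (ρ * B).trace * (ρ * C).trace * (single k l 1 * ⁅ρ, single l k 1 * A⁆).trace +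
          (ρ * C).trace * ((ρ * (single l k 1 * A)).trace * (single k l 1 * ⁅ρ, B⁆).trace) +
          (ρ * B).trace * ((ρ * (single l k 1 * A)).trace * (single k l 1 * ⁅ρ, C⁆).trace) := by
    simp only [commutatorGradient, mul_add, Matrix.mul_smul, trace_add, trace_smul, smul_eq_mul]
    ring
  simp only [expand, Finset.sum_add_distrib, ← Finset.mul_sum]
  rw [sum_trace_single_mul_lie_single_mul, mixed, mixed, hρ]
  ring

end MatrixUnits

variable {d : ℕ}

instance : IsProbabilityMeasure (haarUnitary d) :=
  ⟨Measure.haarMeasure_self⟩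

instance : (haarUnitary d).IsMulLeftInvariant :=
  inferInstanceAs (Measure.haarMeasure ⊤).IsMulLeftInvariant

variable [NeZero d]

theorem pureState_eq_ketbra (U : unitaryGroup (Fin d) ℂ) :
    pureState U = ketbra (WithLp.toLp 2 (U.1 *ᵥ Pi.single 0 1)) :=
  rfl

theorem continuous_pureState :
    Continuous (pureState : unitaryGroup (Fin d) ℂ → Matrix (Fin d) (Fin d) ℂ) :=
  continuous_ketbra.comp <| (PiLp.continuous_toLp 2 _).comp <|
    continuous_subtype_val.matrix_mulVec continuous_const

theorem pureState_mul (V U : unitaryGroup (Fin d) ℂ) :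
    pureState (V * U) = V.1 * pureState U * star V.1 := by
  simp only [pureState, Submonoid.coe_mul, ← mulVec_mulVec]
  rw [mul_vecMulVec, vecMulVec_mul, star_mulVec, star_eq_conjTranspose]

theorem trace_pureState (U : unitaryGroup (Fin d) ℂ) : (pureState U).trace = 1 := by
  rw [pureState, trace_vecMulVec, dotProduct_comm, star_mulVec, ← dotProduct_mulVec,
    mulVec_mulVec, ← star_eq_conjTranspose, mem_unitaryGroup_iff'.mp U.2]
  simp

theorem continuous_trace_mul_commutatorGradient (X A B C : Matrix (Fin d) (Fin d) ℂ) :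
    Continuous fun U : unitaryGroup (Fin d) ℂ =>
      (X * commutatorGradient A B C (pureState U)).trace := by
  have hρ := continuous_pureState (d := d)
  simp only [commutatorGradient, Ring.lie_def]
  fun_prop

theorem integral_trace_mul_commutatorGradient_of_isSelfAdjoint {H : Matrix (Fin d) (Fin d) ℂ}
    (hH : IsSelfAdjoint H) (A B C : Matrix (Fin d) (Fin d) ℂ) :
    ∫ U, (H * commutatorGradient A B C (pureState U)).trace ∂haarUnitary d = 0 := by
  obtain ⟨γ, hγ, hderiv⟩ := exists_unitaryGroup_flow hH
  have hρ := continuous_pureState (d := d)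
  have h := integral_eq_zero_of_hasDerivAt_mul_left (μ := haarUnitary d) hγ
    (Φ := fun U => (pureState U * A).trace * (pureState U * B).trace * (pureState U * C).trace)
    (Ψ := fun U => Complex.I * (H * commutatorGradient A B C (pureState U)).trace)
    (by fun_prop) ((continuous_trace_mul_commutatorGradient H A B C).const_mul _) fun U t => ?_
  · rw [integral_const_mul] at h
    exact (mul_eq_zero.mp h).resolve_left Complex.I_ne_zero
  · simp only [pureState_mul]
    refine (((hderiv _ A t).mul (hderiv _ B t)).mul (hderiv _ C t)).congr_deriv ?_
    simp only [commutatorGradient, mul_add, Matrix.mul_smul, trace_add, trace_smul, smul_eq_mul,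
      Pi.mul_apply]
    ring

theorem integral_trace_mul_commutatorGradient (X A B C : Matrix (Fin d) (Fin d) ℂ) :
    ∫ U, (X * commutatorGradient A B C (pureState U)).trace ∂haarUnitary d = 0 := by
  have integrable (Y : Matrix (Fin d) (Fin d) ℂ) : Integrable
      (fun U => (Y * commutatorGradient A B C (pureState U)).trace) (haarUnitary d) :=
    integrable_of_continuous (continuous_trace_mul_commutatorGradient Y A B C)
  rw [← realPart_add_I_smul_imaginaryPart X]
  simp only [add_mul, smul_mul, trace_add, trace_smul, smul_eq_mul]
  rw [integral_add (integrable _) ((integrable _).const_mul _), integral_const_mul,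
    integral_trace_mul_commutatorGradient_of_isSelfAdjoint (realPart X).2,
    integral_trace_mul_commutatorGradient_of_isSelfAdjoint (imaginaryPart X).2, mul_zero, add_zero]

/-- The third moment `∫ tr(ρA) tr(ρB) tr(ρC)` of a Haar random pure state `ρ`. -/
noncomputable def haarMoment (A B C : Matrix (Fin d) (Fin d) ℂ) : ℂ :=
  ∫ U, (pureState U * A).trace * (pureState U * B).trace * (pureState U * C).trace ∂haarUnitary d

theorem integrable_haarMoment (A B C : Matrix (Fin d) (Fin d) ℂ) :
    Integrable (fun U => (pureState U * A).trace * (pureState U * B).trace *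
      (pureState U * C).trace) (haarUnitary d) := by
  have hρ := continuous_pureState (d := d)
  exact integrable_of_continuous (by fun_prop)

theorem haarMoment_swap_left (A B C : Matrix (Fin d) (Fin d) ℂ) :
    haarMoment A B C = haarMoment B A C := by
  simp only [haarMoment, mul_comm]

theorem haarMoment_swap_right (A B C : Matrix (Fin d) (Fin d) ℂ) :
    haarMoment A B C = haarMoment A C B := by
  simp only [haarMoment, mul_right_comm]

theorem integral_sum_trace_single_mul_commutatorGradient (A B C : Matrix (Fin d) (Fin d) ℂ) :
    ∫ U, ∑ k, ∑ l, (single k l 1 *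
      commutatorGradient (single l k 1 * A) B C (pureState U)).trace ∂haarUnitary d = 0 := by
  have integrable (k l : Fin d) := integrable_of_continuous (μ := haarUnitary d)
    (continuous_trace_mul_commutatorGradient (single k l 1) (single l k 1 * A) B C)
  rw [integral_finsetSum _ fun k _ => integrable_finsetSum _ fun l _ => integrable k l]
  simp_rw [integral_finsetSum _ fun l _ => integrable _ l, integral_trace_mul_commutatorGradient,
    Finset.sum_const_zero]

theorem haarMoment_recursion (A B C : Matrix (Fin d) (Fin d) ℂ) :
    ((d : ℂ) + 2) * haarMoment A B C =
      A.trace * haarMoment 1 B C + haarMoment 1 (B * A) C + haarMoment 1 (C * A) B := by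
  have expand (U : unitaryGroup (Fin d) ℂ) := sum_trace_single_mul_commutatorGradient
    (trace_pureState U) (ketbra_mul_mul_ketbra (WithLp.toLp 2 (U.1 *ᵥ Pi.single 0 1))) A B C
  have h := integral_sum_trace_single_mul_commutatorGradient A B C
  have integrable_one (B C : Matrix (Fin d) (Fin d) ℂ) := integrable_haarMoment 1 B C
  have haarMoment_one (B C : Matrix (Fin d) (Fin d) ℂ) : haarMoment 1 B C =
      ∫ U, (pureState U * B).trace * (pureState U * C).trace ∂haarUnitary d := by
    simp only [haarMoment, mul_one, trace_pureState, one_mul]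
  simp only [mul_one, trace_pureState, one_mul] at integrable_one
  simp_rw [expand, Fintype.card_fin] at h
  have i₁ := (integrable_one B C).const_mul A.trace
  have i₂ := integrable_one (B * A) C
  have i₃ := integrable_one (C * A) B
  have i₄ := (integrable_haarMoment A B C).const_mul ((d : ℂ) + 2)
  have h' := (integral_sub ((i₁.add i₂).add i₃) i₄).symm.trans h
  rw [integral_add' (i₁.add i₂) i₃, integral_add' i₁ i₂, integral_const_mul, integral_const_mul,
    ← haarMoment_one, ← haarMoment_one, ← haarMoment_one] at h'
  exact (sub_eq_zero.mp h').symm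

end Moments

section EstimationOperator

variable {n : Type*} [Fintype n] [DecidableEq n]

/-- `6 tr₁₂ (P_sym (A ⊗ B ⊗ 1))`, where `P_sym` projects onto the symmetric subspace of three
copies: up to normalization, the operator whose expectation value is the fidelity of an estimate
reported on the outcome `A ⊗ B`. -/
def estimationOperator (A B : Matrix n n ℂ) : Matrix n n ℂ :=
  (A.trace * B.trace + (A * B).trace) • 1 + B.trace • A + A.trace • B + A * B + B * A

theorem trace_estimationOperator_mul (A B C : Matrix n n ℂ) :
    (estimationOperator A B * C).trace =
      (A.trace * B.trace + (A * B).trace) * C.trace + B.trace * (A * C).trace +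
        A.trace * (B * C).trace + (A * B * C).trace + (B * A * C).trace := by
  simp only [estimationOperator, add_mul, smul_mul, one_mul, trace_add, trace_smul, smul_eq_mul]

end EstimationOperator

theorem haarMoment_eq {d : ℕ} [NeZero d] (A B C : Matrix (Fin d) (Fin d) ℂ) :
    haarMoment A B C =
      (estimationOperator A B * C).trace / ((d : ℂ) * ((d : ℂ) + 1) * ((d : ℂ) + 2)) := by
  have h0 : (d : ℂ) ≠ 0 := by exact_mod_cast NeZero.ne d
  have h1 : (d : ℂ) + 1 ≠ 0 := by exact_mod_cast Nat.succ_ne_zero d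
  have h2 : (d : ℂ) + 2 ≠ 0 := by exact_mod_cast Nat.succ_ne_zero (d + 1)
  have zeroth : haarMoment (1 : Matrix (Fin d) (Fin d) ℂ) 1 1 = 1 := by
    simp [haarMoment, trace_pureState]
  have first (C : Matrix (Fin d) (Fin d) ℂ) : haarMoment 1 1 C = C.trace / d := by
    have h := haarMoment_recursion C 1 1
    rw [one_mul, haarMoment_swap_left, haarMoment_swap_right, zeroth] at h
    field_simp
    linear_combination h
  have second (B C : Matrix (Fin d) (Fin d) ℂ) :
      haarMoment 1 B C = (B.trace * C.trace + (C * B).trace) / (d * (d + 1)) := by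
    have h := haarMoment_recursion B 1 C
    rw [one_mul, haarMoment_swap_left B, haarMoment_swap_right 1 (C * B) 1, first, first] at h
    field_simp at h ⊢
    linear_combination h
  have third := haarMoment_recursion A B C
  rw [second, second, second, trace_mul_comm C (B * A), trace_mul_comm B (C * A),
    ← trace_mul_cycle A B C, trace_mul_comm B A, trace_mul_comm C A, trace_mul_comm C B] at third
  rw [trace_estimationOperator_mul]
  field_simp at third ⊢
  linear_combination third

/-! ### A quadratic form bounded by the overlap of two vectors -/

section OverlapForm

variable {E : Type*} [NormedAddCommGroup E] [InnerProductSpace ℂ E]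

/-- The part of `⟨v| estimationOperator (|a⟩⟨a|) (|b⟩⟨b|) |v⟩` that depends on the direction
of `v`. -/
noncomputable def overlapForm (a b v : E) : ℝ :=
  ‖b‖ ^ 2 * ‖⟪a, v⟫_ℂ‖ ^ 2 + ‖a‖ ^ 2 * ‖⟪b, v⟫_ℂ‖ ^ 2 +
    2 * (⟪v, a⟫_ℂ * ⟪a, b⟫_ℂ * ⟪b, v⟫_ℂ).re

/-- The operator `‖b‖² |a⟩⟨a| + ‖a‖² |b⟩⟨b|`, whose square controls `overlapForm a b`. -/
noncomputable def overlapMap (a b v : E) : E :=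
  (((‖b‖ ^ 2 : ℝ) : ℂ) * ⟪a, v⟫_ℂ) • a + (((‖a‖ ^ 2 : ℝ) : ℂ) * ⟪b, v⟫_ℂ) • b

theorem norm_overlapMap_sq (a b v : E) :
    ‖overlapMap a b v‖ ^ 2 = (‖a‖ * ‖b‖) ^ 2 * overlapForm a b v := by
  have cross : ⟪(((‖b‖ ^ 2 : ℝ) : ℂ) * ⟪a, v⟫_ℂ) • a, (((‖a‖ ^ 2 : ℝ) : ℂ) * ⟪b, v⟫_ℂ) • b⟫_ℂ =
      ((‖a‖ ^ 2 * ‖b‖ ^ 2 : ℝ) : ℂ) * (⟪v, a⟫_ℂ * ⟪a, b⟫_ℂ * ⟪b, v⟫_ℂ) := by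
    rw [inner_smul_left, inner_smul_right, map_mul, Complex.conj_ofReal, inner_conj_symm,
      Complex.ofReal_mul]
    ring
  rw [overlapMap, norm_add_sq (𝕜 := ℂ), cross, RCLike.re_eq_complex_re, Complex.re_ofReal_mul,
    norm_smul, norm_smul, norm_mul, norm_mul, Complex.norm_of_nonneg (by positivity),
    Complex.norm_of_nonneg (by positivity), overlapForm]
  ring

theorem inner_overlapMap_right (a b v : E) :
    ⟪v, overlapMap a b v⟫_ℂ =
      ((‖b‖ ^ 2 * ‖⟪a, v⟫_ℂ‖ ^ 2 + ‖a‖ ^ 2 * ‖⟪b, v⟫_ℂ‖ ^ 2 : ℝ) : ℂ) := by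
  rw [overlapMap, inner_add_right, inner_smul_right, inner_smul_right, mul_assoc, mul_assoc,
    ← inner_conj_symm v a, ← inner_conj_symm v b, Complex.mul_conj', Complex.mul_conj']
  push_cast
  rfl

theorem norm_mul_norm_mul_overlapForm_le (a b v : E) :
    ‖a‖ * ‖b‖ * overlapForm a b v ≤
      (‖a‖ * ‖b‖ + ‖⟪a, b⟫_ℂ‖) * (‖b‖ ^ 2 * ‖⟪a, v⟫_ℂ‖ ^ 2 + ‖a‖ ^ 2 * ‖⟪b, v⟫_ℂ‖ ^ 2) := by
  have cross : (⟪v, a⟫_ℂ * ⟪a, b⟫_ℂ * ⟪b, v⟫_ℂ).re ≤ ‖⟪a, b⟫_ℂ‖ * (‖⟪a, v⟫_ℂ‖ * ‖⟪b, v⟫_ℂ‖) := by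
    refine (Complex.re_le_norm _).trans_eq ?_
    rw [norm_mul, norm_mul, norm_inner_symm v a]
    ring
  have amgm := two_mul_le_add_sq (‖b‖ * ‖⟪a, v⟫_ℂ‖) (‖a‖ * ‖⟪b, v⟫_ℂ‖)
  rw [overlapForm]
  linear_combination 2 * ‖a‖ * ‖b‖ * cross + ‖⟪a, b⟫_ℂ‖ * amgm

theorem norm_overlapMap_le (a b v : E) :
    ‖overlapMap a b v‖ ≤ ‖a‖ * ‖b‖ * (‖a‖ * ‖b‖ + ‖⟪a, b⟫_ℂ‖) * ‖v‖ := by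
  have cauchy : ‖b‖ ^ 2 * ‖⟪a, v⟫_ℂ‖ ^ 2 + ‖a‖ ^ 2 * ‖⟪b, v⟫_ℂ‖ ^ 2 ≤
      ‖v‖ * ‖overlapMap a b v‖ := by
    have h := norm_inner_le_norm (𝕜 := ℂ) v (overlapMap a b v)
    rwa [inner_overlapMap_right, Complex.norm_of_nonneg (by positivity)] at h
  rcases (norm_nonneg (overlapMap a b v)).eq_or_lt with h | h
  · rw [← h]
    positivity
  refine le_of_mul_le_mul_right ?_ h
  calc ‖overlapMap a b v‖ * ‖overlapMap a b v‖
      = ‖a‖ * ‖b‖ * (‖a‖ * ‖b‖ * overlapForm a b v) := by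
        rw [← sq, norm_overlapMap_sq]
        ring
    _ ≤ ‖a‖ * ‖b‖ * ((‖a‖ * ‖b‖ + ‖⟪a, b⟫_ℂ‖) * (‖v‖ * ‖overlapMap a b v‖)) := by
        refine mul_le_mul_of_nonneg_left ?_ (by positivity)
        exact (norm_mul_norm_mul_overlapForm_le a b v).trans (by gcongr)
    _ = ‖a‖ * ‖b‖ * (‖a‖ * ‖b‖ + ‖⟪a, b⟫_ℂ‖) * ‖v‖ * ‖overlapMap a b v‖ := by ring

theorem overlapForm_zero_left (b v : E) : overlapForm 0 b v = 0 := by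
  simp [overlapForm]

theorem overlapForm_zero_middle (a v : E) : overlapForm a 0 v = 0 := by
  simp [overlapForm]

theorem overlapForm_le (a b v : E) :
    overlapForm a b v ≤ (‖a‖ * ‖b‖ + ‖⟪a, b⟫_ℂ‖) ^ 2 * ‖v‖ ^ 2 := by
  rcases eq_or_ne a 0 with rfl | ha
  · rw [overlapForm_zero_left]
    positivity
  rcases eq_or_ne b 0 with rfl | hb
  · rw [overlapForm_zero_middle]
    positivity
  have hab : 0 < (‖a‖ * ‖b‖) ^ 2 := by positivity
  refine le_of_mul_le_mul_left ?_ hab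
  rw [← norm_overlapMap_sq, ← mul_pow, ← mul_pow, ← mul_assoc]
  exact pow_le_pow_left₀ (norm_nonneg _) (norm_overlapMap_le a b v) 2

theorem overlapMap_eq_smul_of_overlapForm_eq {a b v : E}
    (h : overlapForm a b v = (‖a‖ * ‖b‖ + ‖⟪a, b⟫_ℂ‖) ^ 2 * ‖v‖ ^ 2) :
    overlapMap a b v = ((‖a‖ * ‖b‖ * (‖a‖ * ‖b‖ + ‖⟪a, b⟫_ℂ‖) : ℝ) : ℂ) • v := by
  have hle := mul_le_mul_of_nonneg_left (norm_mul_norm_mul_overlapForm_le a b v)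
    (by positivity : 0 ≤ ‖a‖ * ‖b‖)
  rw [h] at hle
  rw [← sub_eq_zero, ← norm_eq_zero, ← sq_eq_zero_iff]
  refine le_antisymm ?_ (sq_nonneg _)
  rw [norm_sub_sq (𝕜 := ℂ), norm_overlapMap_sq, h, inner_smul_right, ← inner_conj_symm _ v,
    inner_overlapMap_right, Complex.conj_ofReal, ← Complex.ofReal_mul, RCLike.re_eq_complex_re,
    Complex.ofReal_re, norm_smul, Complex.norm_of_nonneg (by positivity)]
  linear_combination 2 * hle

theorem overlapForm_smul_middle (r : ℂ) (a b v : E) :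
    overlapForm a (r • b) v = ‖r‖ ^ 2 * overlapForm a b v := by
  have cross : ⟪v, a⟫_ℂ * (r * ⟪a, b⟫_ℂ) * (starRingEnd ℂ r * ⟪b, v⟫_ℂ) =
      ((‖r‖ ^ 2 : ℝ) : ℂ) * (⟪v, a⟫_ℂ * ⟪a, b⟫_ℂ * ⟪b, v⟫_ℂ) := by
    rw [Complex.ofReal_pow, ← Complex.conj_mul']
    ring
  rw [overlapForm, overlapForm, inner_smul_right, inner_smul_left, cross, Complex.re_ofReal_mul,
    norm_mul, RCLike.norm_conj, norm_smul]
  ring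

theorem norm_smul_add_smul_sq_of_inner_eq_norm {a b : E} (h : ⟪a, b⟫_ℂ = ‖⟪a, b⟫_ℂ‖) :
    ‖(‖b‖ : ℂ) • a + (‖a‖ : ℂ) • b‖ ^ 2 =
      2 * (‖a‖ * ‖b‖) * (‖a‖ * ‖b‖ + ‖⟪a, b⟫_ℂ‖) := by
  rw [norm_add_sq (𝕜 := ℂ), inner_smul_left, inner_smul_right, h, Complex.conj_ofReal,
    ← Complex.ofReal_mul, ← Complex.ofReal_mul, RCLike.re_eq_complex_re, Complex.ofReal_re,
    norm_smul, norm_smul, Complex.norm_real, Complex.norm_real, Complex.norm_real,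
    norm_norm, norm_norm, norm_norm]
  ring

theorem overlapForm_add_of_inner_eq_norm {a b : E} (h : ⟪a, b⟫_ℂ = ‖⟪a, b⟫_ℂ‖) :
    overlapForm a b ((‖b‖ : ℂ) • a + (‖a‖ : ℂ) • b) = (‖a‖ * ‖b‖ + ‖⟪a, b⟫_ℂ‖) ^ 2 *
      ‖(‖b‖ : ℂ) • a + (‖a‖ : ℂ) • b‖ ^ 2 := by
  set s := ‖⟪a, b⟫_ℂ‖
  have h' : ⟪b, a⟫_ℂ = s := by rw [← inner_conj_symm, h, Complex.conj_ofReal]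
  set v := (‖b‖ : ℂ) • a + (‖a‖ : ℂ) • b with hv
  have hav : ⟪a, v⟫_ℂ = ((‖a‖ * (‖a‖ * ‖b‖ + s) : ℝ) : ℂ) := by
    rw [hv, inner_add_right, inner_smul_right, inner_smul_right, inner_self_eq_norm_sq_to_K, h,
      RCLike.ofReal_eq_complex_ofReal]
    push_cast
    ring
  have hbv : ⟪b, v⟫_ℂ = ((‖b‖ * (‖a‖ * ‖b‖ + s) : ℝ) : ℂ) := by
    rw [hv, inner_add_right, inner_smul_right, inner_smul_right, inner_self_eq_norm_sq_to_K, h',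
      RCLike.ofReal_eq_complex_ofReal]
    push_cast
    ring
  rw [overlapForm, ← inner_conj_symm v a, hav, hbv, h,
    norm_smul_add_smul_sq_of_inner_eq_norm h, Complex.conj_ofReal,
    ← Complex.ofReal_mul, ← Complex.ofReal_mul, Complex.ofReal_re, Complex.norm_real,
    Complex.norm_real, Real.norm_eq_abs, Real.norm_eq_abs, sq_abs, sq_abs]
  ring

theorem exists_overlapForm_eq [Nontrivial E] (a b : E) :
    ∃ v ≠ 0, overlapForm a b v = (‖a‖ * ‖b‖ + ‖⟪a, b⟫_ℂ‖) ^ 2 * ‖v‖ ^ 2 := by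
  obtain ⟨u, hu⟩ := exists_ne (0 : E)
  rcases eq_or_ne a 0 with rfl | ha
  · exact ⟨u, hu, by simp [overlapForm_zero_left]⟩
  rcases eq_or_ne b 0 with rfl | hb
  · exact ⟨u, hu, by simp [overlapForm_zero_middle]⟩
  obtain ⟨ω, hω, hs⟩ := RCLike.exists_norm_eq_mul_self ⟪a, b⟫_ℂ
  have hinner : ‖⟪a, ω • b⟫_ℂ‖ = ‖⟪a, b⟫_ℂ‖ := by rw [inner_smul_right, norm_mul, hω, one_mul]
  have hnorm : ‖ω • b‖ = ‖b‖ := by rw [norm_smul, hω, one_mul]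
  have h : ⟪a, ω • b⟫_ℂ = ‖⟪a, ω • b⟫_ℂ‖ := by rw [hinner, inner_smul_right]; exact hs.symm
  have hform := overlapForm_add_of_inner_eq_norm h
  rw [overlapForm_smul_middle, hω, one_pow, one_mul, hinner, hnorm] at hform
  refine ⟨_, fun hv => ?_, hform⟩
  have hpos := norm_smul_add_smul_sq_of_inner_eq_norm h
  rw [hnorm, hv, norm_zero, zero_pow two_ne_zero] at hpos
  refine absurd hpos (ne_of_lt ?_)
  positivity

/-- The gap between `⟨v| estimationOperator (|a⟩⟨a|) (|b⟩⟨b|) |v⟩` for a unit vector `v` and its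
upper bound linear in the traces of the operators, which is attained at overlap `c`. -/
noncomputable def overlapGap (c : ℝ) (a b v : E) : ℝ :=
  ((1 + c) * (‖a‖ ^ 2 * ‖b‖ ^ 2) + (1 + c⁻¹) * ‖⟪a, b⟫_ℂ‖ ^ 2) * ‖v‖ ^ 2 - overlapForm a b v

theorem overlapGap_eq {c : ℝ} (hc : c ≠ 0) (a b v : E) :
    overlapGap c a b v = c⁻¹ * (‖⟪a, b⟫_ℂ‖ - c * (‖a‖ * ‖b‖)) ^ 2 * ‖v‖ ^ 2 +
      ((‖a‖ * ‖b‖ + ‖⟪a, b⟫_ℂ‖) ^ 2 * ‖v‖ ^ 2 - overlapForm a b v) := by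
  rw [overlapGap]
  field_simp
  ring

theorem overlapGap_nonneg {c : ℝ} (hc : 0 < c) (a b v : E) : 0 ≤ overlapGap c a b v := by
  rw [overlapGap_eq hc.ne']
  exact add_nonneg (by positivity) (sub_nonneg.mpr (overlapForm_le a b v))

theorem overlapGap_eq_zero_iff {c : ℝ} (hc : 0 < c) {a b v : E} (hv : v ≠ 0) :
    overlapGap c a b v = 0 ↔ ‖⟪a, b⟫_ℂ‖ = c * (‖a‖ * ‖b‖) ∧
      overlapForm a b v = (‖a‖ * ‖b‖ + ‖⟪a, b⟫_ℂ‖) ^ 2 * ‖v‖ ^ 2 := by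
  rw [overlapGap_eq hc.ne', add_eq_zero_iff_of_nonneg (by positivity)
    (sub_nonneg.mpr (overlapForm_le a b v)), sub_eq_zero, eq_comm (a := overlapForm a b v)]
  simp [hc.ne', hv, sub_eq_zero]

theorem exists_eq_smul_of_overlapGap_eq_zero {c : ℝ} (hc : 0 < c) {a b v : E} (hb : b ≠ 0)
    (hv : v ≠ 0) (h : overlapGap c a b v = 0) :
    ∃ μ : ℂ, a = μ • ((((1 + c) * ‖b‖ ^ 2 : ℝ) : ℂ) • v - ⟪b, v⟫_ℂ • b) := by
  rcases eq_or_ne a 0 with rfl | ha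
  · exact ⟨0, (zero_smul _ _).symm⟩
  obtain ⟨hs, hform⟩ := (overlapGap_eq_zero_iff hc hv).mp h
  have hmap : (((‖b‖ ^ 2 : ℝ) : ℂ) * ⟪a, v⟫_ℂ) • a = ((‖a‖ ^ 2 : ℝ) : ℂ) •
      ((((1 + c) * ‖b‖ ^ 2 : ℝ) : ℂ) • v - ⟪b, v⟫_ℂ • b) := by
    rw [smul_sub, smul_smul, smul_smul, eq_sub_iff_add_eq, ← overlapMap,
      overlapMap_eq_smul_of_overlapForm_eq hform, hs, ← Complex.ofReal_mul]
    congr 2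
    ring
  have hav : ⟪a, v⟫_ℂ ≠ 0 := by
    intro hav
    rw [hav, mul_zero, zero_smul, eq_comm, smul_eq_zero_iff_right (by simpa using ha),
      sub_eq_zero] at hmap
    have hab : ⟪a, b⟫_ℂ ≠ 0 := by
      rw [← norm_ne_zero_iff, hs]
      positivity
    have hbv : ⟪b, v⟫_ℂ = 0 := by
      have h := congrArg (fun w => ⟪a, w⟫_ℂ) hmap
      simpa [inner_smul_right, hav, hab] using h
    rw [hbv, zero_smul] at hmap
    refine smul_ne_zero (Complex.ofReal_ne_zero.mpr ?_) hv hmap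
    positivity
  refine ⟨(((‖b‖ ^ 2 : ℝ) : ℂ) * ⟪a, v⟫_ℂ)⁻¹ * ((‖a‖ ^ 2 : ℝ) : ℂ), ?_⟩
  rw [mul_smul, ← hmap, inv_smul_smul₀]
  exact mul_ne_zero (by simpa using hb) hav

end OverlapForm

/-! ### The estimation fidelity of a product measurement -/

section MaxExpectation

variable {n : Type*} [Fintype n]

/-- The largest expectation value `⟨v| Q |v⟩` over unit vectors `v`; for Hermitian `Q` this is the
largest eigenvalue. -/
noncomputable def maxExpectation (Q : Matrix n n ℂ) : ℝ :=
  ⨆ v : Metric.sphere (0 : EuclideanSpace ℂ n) 1, (Q * ketbra v.1).trace.re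

theorem continuous_re_trace_mul_ketbra (Q : Matrix n n ℂ) :
    Continuous fun v : Metric.sphere (0 : EuclideanSpace ℂ n) 1 => (Q * ketbra v.1).trace.re := by
  have h := continuous_ketbra (n := n)
  fun_prop

theorem exists_re_trace_mul_ketbra_eq_maxExpectation [Nonempty n] (Q : Matrix n n ℂ) :
    ∃ v : EuclideanSpace ℂ n, ‖v‖ = 1 ∧ (Q * ketbra v).trace.re = maxExpectation Q := by
  have : Nonempty (Metric.sphere (0 : EuclideanSpace ℂ n) 1) :=
    (NormedSpace.sphere_nonempty.mpr zero_le_one).to_subtype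
  obtain ⟨v, hv⟩ :=
    (isCompact_range (continuous_re_trace_mul_ketbra Q)).sSup_mem (Set.range_nonempty _)
  exact ⟨v, mem_sphere_zero_iff_norm.mp v.2, hv⟩

theorem re_trace_mul_ketbra_smul (Q : Matrix n n ℂ) (r : ℂ) (v : EuclideanSpace ℂ n) :
    (Q * ketbra (r • v)).trace.re = ‖r‖ ^ 2 * (Q * ketbra v).trace.re := by
  rw [ketbra_smul, Matrix.mul_smul, trace_smul, smul_eq_mul, Complex.re_ofReal_mul]

theorem re_trace_mul_ketbra_le (Q : Matrix n n ℂ) (v : EuclideanSpace ℂ n) :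
    (Q * ketbra v).trace.re ≤ maxExpectation Q * ‖v‖ ^ 2 := by
  rcases eq_or_ne v 0 with rfl | hv
  · simp [ketbra_zero]
  have h := le_ciSup (isCompact_range (continuous_re_trace_mul_ketbra Q)).bddAbove
    ⟨((‖v‖⁻¹ : ℝ) : ℂ) • v, mem_sphere_zero_iff_norm.mpr (by simp [norm_smul, hv])⟩
  rw [re_trace_mul_ketbra_smul, Complex.norm_real, norm_inv, norm_norm, inv_pow,
    inv_mul_le_iff₀ (by positivity), mul_comm] at h
  exact h

theorem re_trace_mul_le_maxExpectation_mul (Q : Matrix n n ℂ) {σ : Matrix n n ℂ}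
    (hσ : σ.PosSemidef) : (Q * σ).trace.re ≤ maxExpectation Q * σ.trace.re := by
  obtain ⟨m, a, rfl⟩ := exists_eq_sum_ketbra hσ
  rw [Finset.mul_sum, trace_sum, trace_sum, Complex.re_sum, Complex.re_sum, Finset.mul_sum]
  refine Finset.sum_le_sum fun i _ => ?_
  rw [trace_ketbra, Complex.ofReal_re]
  exact re_trace_mul_ketbra_le Q (a i)

theorem maxExpectation_eq {Q : Matrix n n ℂ} {m : ℝ} {v : EuclideanSpace ℂ n} (hv : v ≠ 0)
    (heq : (Q * ketbra v).trace.re = m * ‖v‖ ^ 2)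
    (hle : ∀ u, (Q * ketbra u).trace.re ≤ m * ‖u‖ ^ 2) : maxExpectation Q = m := by
  have hpos : 0 < ‖v‖ ^ 2 := by positivity
  refine le_antisymm ?_ (le_of_mul_le_mul_right (heq ▸ re_trace_mul_ketbra_le Q v) hpos)
  have : Nonempty n := by
    by_contra hn
    have := not_nonempty_iff.mp hn
    exact hv (Subsingleton.elim _ _)
  obtain ⟨u, hu, hmax⟩ := exists_re_trace_mul_ketbra_eq_maxExpectation Q
  rw [← hmax]
  simpa only [hu, one_pow, mul_one] using hle u

theorem re_trace_estimationOperator_ketbra_mul [DecidableEq n] (a b v : EuclideanSpace ℂ n) :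
    (estimationOperator (ketbra a) (ketbra b) * ketbra v).trace.re =
      (‖a‖ ^ 2 * ‖b‖ ^ 2 + ‖⟪a, b⟫_ℂ‖ ^ 2) * ‖v‖ ^ 2 + overlapForm a b v := by
  have hconj : ⟪v, b⟫_ℂ * ⟪b, a⟫_ℂ * ⟪a, v⟫_ℂ =
      starRingEnd ℂ (⟪v, a⟫_ℂ * ⟪a, b⟫_ℂ * ⟪b, v⟫_ℂ) := by
    simp only [map_mul, inner_conj_symm]
    ring
  rw [trace_estimationOperator_mul, trace_ketbra_mul_ketbra_mul_ketbra,
    trace_ketbra_mul_ketbra_mul_ketbra, hconj]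
  simp only [trace_ketbra, trace_ketbra_mul_ketbra, ← Complex.ofReal_mul, ← Complex.ofReal_add,
    Complex.add_re, Complex.ofReal_re, Complex.conj_re, overlapForm]
  ring

theorem maxExpectation_estimationOperator_ketbra [DecidableEq n] [Nonempty n]
    (a b : EuclideanSpace ℂ n) :
    maxExpectation (estimationOperator (ketbra a) (ketbra b)) =
      ‖a‖ ^ 2 * ‖b‖ ^ 2 + ‖⟪a, b⟫_ℂ‖ ^ 2 + (‖a‖ * ‖b‖ + ‖⟪a, b⟫_ℂ‖) ^ 2 := by
  obtain ⟨v, hv, heq⟩ := exists_overlapForm_eq a b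
  refine maxExpectation_eq hv ?_ fun u => ?_
  · rw [re_trace_estimationOperator_ketbra_mul, heq, ← add_mul]
  · rw [re_trace_estimationOperator_ketbra_mul]
    linear_combination overlapForm_le a b u

end MaxExpectation

theorem im_trace_mul_eq_zero {n : Type*} [Fintype n] {A B : Matrix n n ℂ} (hA : A.IsHermitian)
    (hB : B.IsHermitian) : (A * B).trace.im = 0 := by
  refine Complex.conj_eq_iff_im.mp ?_
  rw [← Complex.star_def, ← trace_conjTranspose, conjTranspose_mul, hA.eq, hB.eq, trace_mul_comm]

section Fidelity

variable {d : ℕ} [NeZero d] {ι κ : Type*} [Fintype ι] [Fintype κ]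

theorem integral_fidelity (A B : Matrix (Fin d) (Fin d) ℂ) {C : Matrix (Fin d) (Fin d) ℂ}
    (hC : C.IsHermitian) :
    ∫ U, ((pureState U ⊗ₖ pureState U) * (A ⊗ₖ B)).trace.re * (pureState U * C).trace.re
      ∂haarUnitary d =
      (estimationOperator A B * C).trace.re / ((d : ℝ) * (d + 1) * (d + 2)) := by
  have integrand (U : unitaryGroup (Fin d) ℂ) :
      ((pureState U ⊗ₖ pureState U) * (A ⊗ₖ B)).trace.re * (pureState U * C).trace.re =
        RCLike.re ((pureState U * A).trace * (pureState U * B).trace *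
          (pureState U * C).trace) := by
    have hU : (pureState U).IsHermitian :=
      pureState_eq_ketbra U ▸ (posSemidef_ketbra _).isHermitian
    rw [← mul_kronecker_mul, trace_kronecker, RCLike.re_eq_complex_re,
      Complex.mul_re (_ * _), im_trace_mul_eq_zero hU hC, mul_zero, sub_zero]
  simp_rw [integrand]
  rw [integral_re (integrable_haarMoment A B C), ← haarMoment, haarMoment_eq,
    RCLike.re_eq_complex_re, ← Complex.div_ofReal_re]
  push_cast
  rfl

theorem averageFidelity_tensor (A : POVM (Fin d) ι) (B : POVM (Fin d) κ)
    (est : ι × κ → DensityMatrix (Fin d)) :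
    averageFidelity (A.tensor B) est =
      (∑ p, (estimationOperator (A.elem p.1) (B.elem p.2) * (est p).1).trace.re) /
        ((d : ℝ) * (d + 1) * (d + 2)) := by
  rw [averageFidelity, Finset.sum_div]
  exact Finset.sum_congr rfl fun p _ => integral_fidelity _ _ (est p).2.1.isHermitian

theorem estimationFidelity_tensor (A : POVM (Fin d) ι) (B : POVM (Fin d) κ) :
    estimationFidelity (A.tensor B) =
      (∑ p : ι × κ, maxExpectation (estimationOperator (A.elem p.1) (B.elem p.2))) /
        ((d : ℝ) * (d + 1) * (d + 2)) := by
  choose v hv hmax using fun p : ι × κ => exists_re_trace_mul_ketbra_eq_maxExpectation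
    (estimationOperator (A.elem p.1) (B.elem p.2))
  let est (p : ι × κ) : DensityMatrix (Fin d) :=
    ⟨ketbra (v p), posSemidef_ketbra _, by rw [trace_ketbra, hv, one_pow, Complex.ofReal_one]⟩
  have attained : averageFidelity (A.tensor B) est = (∑ p : ι × κ,
      maxExpectation (estimationOperator (A.elem p.1) (B.elem p.2))) /
        ((d : ℝ) * (d + 1) * (d + 2)) := by
    rw [averageFidelity_tensor]
    simp only [est, hmax]
  rw [← attained]
  have hle (e) : averageFidelity (A.tensor B) e ≤ averageFidelity (A.tensor B) est := by
    rw [attained, averageFidelity_tensor]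
    refine div_le_div_of_nonneg_right (Finset.sum_le_sum fun p _ => ?_) (by positivity)
    simpa only [(e p).2.2, Complex.one_re, mul_one] using re_trace_mul_le_maxExpectation_mul
      (estimationOperator (A.elem p.1) (B.elem p.2)) (e p).2.1
  have : Nonempty (ι × κ → DensityMatrix (Fin d)) := ⟨est⟩
  exact le_antisymm (ciSup_le hle) (le_ciSup ⟨_, Set.forall_mem_range.mpr hle⟩ est)

end Fidelity

namespace POVM

variable {n ι κ : Type*} [Fintype n] [DecidableEq n] [Fintype ι] [Fintype κ]

theorem sum_trace (A : POVM n ι) : ∑ j, (A.elem j).trace = Fintype.card n := by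
  rw [← trace_sum, A.sum_elem, trace_one]

theorem sum_trace_mul_trace (A : POVM n ι) (B : POVM n κ) :
    ∑ p : ι × κ, (A.elem p.1).trace * (B.elem p.2).trace = (Fintype.card n : ℂ) ^ 2 := by
  simp only [Fintype.sum_prod_type, ← Finset.mul_sum, ← Finset.sum_mul, sum_trace, sq]

theorem sum_trace_mul (A : POVM n ι) (B : POVM n κ) :
    ∑ p : ι × κ, (A.elem p.1 * B.elem p.2).trace = (Fintype.card n : ℂ) := by
  simp only [Fintype.sum_prod_type, ← trace_sum, ← Finset.mul_sum, B.sum_elem, mul_one,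
    A.sum_elem, trace_one]

end POVM

theorem estimationFidelity_tensor_ketbra {d : ℕ} [NeZero d] {ι κ : Type*} [Fintype ι] [Fintype κ]
    {A : POVM (Fin d) ι} {B : POVM (Fin d) κ} {a : ι → EuclideanSpace ℂ (Fin d)}
    {b : κ → EuclideanSpace ℂ (Fin d)} (ha : ∀ j, A.elem j = ketbra (a j))
    (hb : ∀ k, B.elem k = ketbra (b k)) :
    estimationFidelity (A.tensor B) =
      ((d : ℝ) ^ 2 + d + ∑ p : ι × κ, (‖a p.1‖ * ‖b p.2‖ + ‖⟪a p.1, b p.2⟫_ℂ‖) ^ 2) /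
        ((d : ℝ) * (d + 1) * (d + 2)) := by
  have h1 := A.sum_trace_mul_trace B
  have h2 := A.sum_trace_mul B
  simp only [ha, hb, trace_ketbra, trace_ketbra_mul_ketbra, Fintype.card_fin] at h1 h2
  norm_cast at h1 h2
  simp only [estimationFidelity_tensor, ha, hb, maxExpectation_estimationOperator_ketbra,
    Finset.sum_add_distrib, h1, h2]
  push_cast
  rfl

/-! ### Saturation of the fidelity bound -/

section GapOperator

variable {n : Type*} [Fintype n] [DecidableEq n]

/-- The bilinear extension of `overlapGap` to operators: the multiple of the identity whose
coefficient is the linear upper bound of `overlapGap`, minus `estimationOperator`. -/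
noncomputable def gapOperator (c : ℝ) :
    Matrix n n ℂ →ₗ[ℂ] Matrix n n ℂ →ₗ[ℂ] Matrix n n ℂ :=
  LinearMap.mk₂ ℂ
    (fun A B => (((2 + c : ℝ) : ℂ) * (A.trace * B.trace) + ((2 + c⁻¹ : ℝ) : ℂ) * (A * B).trace) •
      (1 : Matrix n n ℂ) - estimationOperator A B)
    (fun A A' B => by simp only [estimationOperator, add_mul, mul_add, trace_add]; module)
    (fun r A B => by
      simp only [estimationOperator, smul_mul, Matrix.mul_smul, trace_smul, smul_eq_mul]; module)
    (fun A B B' => by simp only [estimationOperator, add_mul, mul_add, trace_add]; module)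
    (fun r A B => by
      simp only [estimationOperator, smul_mul, Matrix.mul_smul, trace_smul, smul_eq_mul]; module)

theorem gapOperator_apply (c : ℝ) (A B : Matrix n n ℂ) :
    gapOperator c A B =
      (((2 + c : ℝ) : ℂ) * (A.trace * B.trace) + ((2 + c⁻¹ : ℝ) : ℂ) * (A * B).trace) • 1 -
        estimationOperator A B :=
  rfl

theorem gapOperator_comm (c : ℝ) (A B : Matrix n n ℂ) : gapOperator c A B = gapOperator c B A := by
  rw [gapOperator_apply, gapOperator_apply, estimationOperator, estimationOperator,
    trace_mul_comm B A, mul_comm B.trace A.trace]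
  abel

theorem re_trace_gapOperator_ketbra_mul (c : ℝ) (a b v : EuclideanSpace ℂ n) :
    (gapOperator c (ketbra a) (ketbra b) * ketbra v).trace.re = overlapGap c a b v := by
  rw [gapOperator_apply, sub_mul, trace_sub, Complex.sub_re,
    re_trace_estimationOperator_ketbra_mul, smul_one_mul, trace_smul, smul_eq_mul, trace_ketbra,
    trace_ketbra, trace_ketbra, trace_ketbra_mul_ketbra, overlapGap]
  norm_cast
  ring

theorem re_trace_gapOperator_sum_ketbra_mul {l m : ℕ} (c : ℝ) (a : Fin l → EuclideanSpace ℂ n)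
    (b : Fin m → EuclideanSpace ℂ n) (v : EuclideanSpace ℂ n) :
    (gapOperator c (∑ i, ketbra (a i)) (∑ k, ketbra (b k)) * ketbra v).trace.re =
      ∑ i, ∑ k, overlapGap c (a i) (b k) v := by
  rw [LinearMap.map_sum₂]
  simp only [map_sum, Finset.sum_mul, trace_sum, Complex.re_sum, re_trace_gapOperator_ketbra_mul]

theorem re_trace_gapOperator_mul_nonneg {c : ℝ} (hc : 0 < c) {A B : Matrix n n ℂ}
    (hA : A.PosSemidef) (hB : B.PosSemidef) (v : EuclideanSpace ℂ n) :
    0 ≤ (gapOperator c A B * ketbra v).trace.re := by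
  obtain ⟨l, a, rfl⟩ := exists_eq_sum_ketbra hA
  obtain ⟨m, b, rfl⟩ := exists_eq_sum_ketbra hB
  rw [re_trace_gapOperator_sum_ketbra_mul]
  exact Finset.sum_nonneg fun i _ => Finset.sum_nonneg fun k _ => overlapGap_nonneg hc _ _ _

theorem exists_eq_ketbra_of_re_trace_gapOperator_eq_zero {c : ℝ} (hc : 0 < c)
    {A B : Matrix n n ℂ} (hA : A.PosSemidef) (hB : B.PosSemidef) (hB0 : B ≠ 0)
    {v : EuclideanSpace ℂ n} (hv : v ≠ 0) (h : (gapOperator c A B * ketbra v).trace.re = 0) :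
    ∃ a, A = ketbra a := by
  obtain ⟨l, a, rfl⟩ := exists_eq_sum_ketbra hA
  obtain ⟨m, b, rfl⟩ := exists_eq_sum_ketbra hB
  obtain ⟨k, hk⟩ : ∃ k, b k ≠ 0 := by
    by_contra! hb
    exact hB0 (Finset.sum_eq_zero fun k _ => by rw [hb, ketbra_zero])
  have hgap (i : Fin l) : overlapGap c (a i) (b k) v = 0 := by
    rw [re_trace_gapOperator_sum_ketbra_mul, Finset.sum_eq_zero_iff_of_nonneg fun i _ =>
      Finset.sum_nonneg fun k _ => overlapGap_nonneg hc _ _ _] at h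
    exact (Finset.sum_eq_zero_iff_of_nonneg fun k _ => overlapGap_nonneg hc _ _ _).mp
      (h i (Finset.mem_univ i)) k (Finset.mem_univ k)
  choose μ hμ using fun i => exists_eq_smul_of_overlapGap_eq_zero hc hk hv (hgap i)
  simp_rw [funext hμ, sum_ketbra_smul]
  exact ⟨_, rfl⟩

end GapOperator

namespace POVM

variable {n ι κ : Type*} [Fintype n] [DecidableEq n] [Fintype ι] [Fintype κ]

theorem exists_elem_ne_zero [Nonempty n] (A : POVM n ι) : ∃ j, A.elem j ≠ 0 := by
  by_contra! h
  exact one_ne_zero (α := Matrix n n ℂ) (by rw [← A.sum_elem, Finset.sum_eq_zero fun j _ => h j])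

theorem sum_re_trace_gapOperator_mul_ketbra (A : POVM n ι) (B : POVM n κ) (c : ℝ)
    {v : ι × κ → EuclideanSpace ℂ n} (hv : ∀ p, ‖v p‖ = 1) :
    ∑ p, (gapOperator c (A.elem p.1) (B.elem p.2) * ketbra (v p)).trace.re =
      (2 + c) * (Fintype.card n : ℝ) ^ 2 + (2 + c⁻¹) * Fintype.card n -
        ∑ p, (estimationOperator (A.elem p.1) (B.elem p.2) * ketbra (v p)).trace.re := by
  simp only [gapOperator_apply, sub_mul, trace_sub, smul_one_mul, trace_smul, trace_ketbra, hv,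
    smul_eq_mul, one_pow, Complex.ofReal_one, mul_one, Complex.sub_re, Finset.sum_sub_distrib]
  rw [← Complex.re_sum, Finset.sum_add_distrib, ← Finset.mul_sum, ← Finset.mul_sum,
    sum_trace_mul_trace, sum_trace_mul]
  norm_cast

end POVM

section Saturation

variable {d : ℕ} [NeZero d] {ι κ : Type*} [Fintype ι] [Fintype κ] {A : POVM (Fin d) ι}
  {B : POVM (Fin d) κ}

theorem exists_re_trace_gapOperator_eq_zero_of_estimationFidelity_eq
    (h : estimationFidelity (A.tensor B) = fidelitySep d) :
    ∃ v : ι × κ → EuclideanSpace ℂ (Fin d), (∀ p, v p ≠ 0) ∧ ∀ p,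
      (gapOperator (√(d : ℝ))⁻¹ (A.elem p.1) (B.elem p.2) * ketbra (v p)).trace.re = 0 := by
  choose v hv hmax using fun p : ι × κ => exists_re_trace_mul_ketbra_eq_maxExpectation
    (estimationOperator (A.elem p.1) (B.elem p.2))
  have hd : (0 : ℝ) < d := Nat.cast_pos.mpr (NeZero.pos d)
  have hsum : ∑ p : ι × κ, maxExpectation (estimationOperator (A.elem p.1) (B.elem p.2)) =
      2 * (d + 1 + √(d : ℝ)) * d := by
    rw [estimationFidelity_tensor, fidelitySep, div_eq_div_iff (by positivity) (by positivity)] at h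
    exact mul_right_cancel₀ (b := ((d : ℝ) + 1) * (d + 2)) (by positivity) (by rw [h]; ring)
  have hgap := A.sum_re_trace_gapOperator_mul_ketbra B (√(d : ℝ))⁻¹ hv
  -- The linear bound behind `gapOperator c` sums to `(2 + c) d² + (2 + c⁻¹) d`, which is smallest,
  -- and equal to the sum attained by mutually unbiased bases, at `c = 1 / √d`.
  have hzero : (2 + (√(d : ℝ))⁻¹) * (d : ℝ) ^ 2 + (2 + √(d : ℝ)) * d -
      2 * (d + 1 + √(d : ℝ)) * d = 0 := by
    have hsqrt : (√(d : ℝ))⁻¹ * d = √(d : ℝ) := by rw [inv_mul_eq_div, Real.div_sqrt]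
    linear_combination (d : ℝ) * hsqrt
  simp only [hmax, hsum, Fintype.card_fin, inv_inv, hzero] at hgap
  rw [Finset.sum_eq_zero_iff_of_nonneg fun p _ => re_trace_gapOperator_mul_nonneg (by positivity)
    (A.posSemidef p.1) (B.posSemidef p.2) (v p)] at hgap
  exact ⟨v, fun p => norm_ne_zero_iff.mp (by rw [hv]; exact one_ne_zero),
    fun p => hgap p (Finset.mem_univ p)⟩

theorem exists_ketbra_of_estimationFidelity_eq
    (h : estimationFidelity (A.tensor B) = fidelitySep d) :
    ∃ (a : ι → EuclideanSpace ℂ (Fin d)) (b : κ → EuclideanSpace ℂ (Fin d)),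
      (∀ j, A.elem j = ketbra (a j)) ∧ (∀ k, B.elem k = ketbra (b k)) ∧
      ∀ j k, ‖⟪a j, b k⟫_ℂ‖ = (√(d : ℝ))⁻¹ * (‖a j‖ * ‖b k‖) := by
  have hc : 0 < (√(d : ℝ))⁻¹ :=
    inv_pos.mpr (Real.sqrt_pos.mpr (Nat.cast_pos.mpr (NeZero.pos d)))
  obtain ⟨v, hv, hgap⟩ := exists_re_trace_gapOperator_eq_zero_of_estimationFidelity_eq h
  obtain ⟨j₀, hj₀⟩ := A.exists_elem_ne_zero
  obtain ⟨k₀, hk₀⟩ := B.exists_elem_ne_zero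
  choose a ha using fun j => exists_eq_ketbra_of_re_trace_gapOperator_eq_zero hc (A.posSemidef j)
    (B.posSemidef k₀) hk₀ (hv (j, k₀)) (hgap (j, k₀))
  choose b hb using fun k => exists_eq_ketbra_of_re_trace_gapOperator_eq_zero hc (B.posSemidef k)
    (A.posSemidef j₀) hj₀ (hv (j₀, k)) (gapOperator_comm _ (A.elem j₀) (B.elem k) ▸ hgap (j₀, k))
  refine ⟨a, b, ha, hb, fun j k => ((overlapGap_eq_zero_iff hc (hv (j, k))).mp ?_).1⟩
  rw [← re_trace_gapOperator_ketbra_mul, ← ha, ← hb]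
  exact hgap (j, k)

end Saturation

namespace POVM

section RankOneElements

variable {n ι : Type*} [Fintype n] [DecidableEq n] [Fintype ι] {A : POVM n ι}
  {a : ι → EuclideanSpace ℂ n}

theorem isRankOneProjective_of_orthogonal (ha : ∀ j, A.elem j = ketbra (a j))
    (hne : ∀ j, a j ≠ 0) (hort : Pairwise fun i j => ⟪a i, a j⟫_ℂ = 0) :
    A.IsRankOneProjective := by
  have hmul (i j : ι) (hij : i ≠ j) : A.elem i * A.elem j = 0 := by
    rw [ha, ha, ketbra_mul_ketbra, hort hij, zero_smul]
  have hidem (j : ι) : A.elem j * A.elem j = A.elem j := calc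
    A.elem j * A.elem j = ∑ i, A.elem j * A.elem i :=
      (Fintype.sum_eq_single j fun i hi => hmul j i hi.symm).symm
    _ = A.elem j := by rw [← Finset.mul_sum, A.sum_elem, mul_one]
  exact ⟨fun j => ⟨⟨hidem j, (A.posSemidef j).isHermitian⟩, by rw [ha, rank_ketbra (hne j)]⟩, hmul⟩

theorem IsSimple.elem_ne_zero [Nonempty n] (hA : A.IsSimple) (j : ι) : A.elem j ≠ 0 := by
  obtain ⟨i, hi⟩ := A.exists_elem_ne_zero
  rcases eq_or_ne i j with rfl | hij
  · exact hi
  · exact (hA i j hij).ne_zero 1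

theorem IsSimple.norm_inner_ne (hA : A.IsSimple) (ha : ∀ j, A.elem j = ketbra (a j)) {i j : ι}
    (hij : i ≠ j) : ‖⟪a i, a j⟫_ℂ‖ ≠ ‖a i‖ * ‖a j‖ := by
  intro heq
  have hlin := hA i j hij
  have hai : a i ≠ 0 := fun h0 => hlin.ne_zero 0 (by simp [ha, h0, ketbra_zero])
  obtain ⟨r, hr⟩ := (((norm_inner_eq_norm_tfae ℂ (a i) (a j)).out 0 2 :
    ‖⟪a i, a j⟫_ℂ‖ = ‖a i‖ * ‖a j‖ ↔ a i = 0 ∨ ∃ r : ℂ, a j = r • a i).mp heq).resolve_left hai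
  have hzero := (LinearIndependent.pair_iff.mp hlin ((‖r‖ ^ 2 : ℝ) : ℂ) (-1)
    (by rw [ha, ha, hr, ketbra_smul, neg_one_smul, add_neg_cancel])).2
  exact neg_ne_zero.mpr one_ne_zero hzero

end RankOneElements

end POVM

theorem norm_inner_eq_zero_or_eq_of_estimationFidelity_eq {d : ℕ} [NeZero d] {ι : Type*}
    [Fintype ι] {A : POVM (Fin d) ι} {a : ι → EuclideanSpace ℂ (Fin d)}
    (ha : ∀ j, A.elem j = ketbra (a j))
    (h : estimationFidelity (A.tensor A) = 2 / ((d : ℝ) + 1)) (i j : ι) :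
    ‖⟪a i, a j⟫_ℂ‖ = 0 ∨ ‖⟪a i, a j⟫_ℂ‖ = ‖a i‖ * ‖a j‖ := by
  have hd : (0 : ℝ) < d := Nat.cast_pos.mpr (NeZero.pos d)
  rw [estimationFidelity_tensor_ketbra ha ha, div_eq_div_iff (by positivity) (by positivity)] at h
  have hnorm := A.sum_trace_mul_trace A
  have hinner := A.sum_trace_mul A
  simp only [ha, trace_ketbra, trace_ketbra_mul_ketbra, Fintype.card_fin] at hnorm hinner
  norm_cast at hnorm hinner
  have hadd : ∑ p : ι × ι, (‖a p.1‖ * ‖a p.2‖ + ‖⟪a p.1, a p.2⟫_ℂ‖) ^ 2 = d ^ 2 + 3 * d :=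
    mul_right_cancel₀ (b := (d : ℝ) + 1) (by positivity) (by linear_combination h)
  have hterm (p : ι × ι) : ‖⟪a p.1, a p.2⟫_ℂ‖ * (‖a p.1‖ * ‖a p.2‖ - ‖⟪a p.1, a p.2⟫_ℂ‖) =
      1 / 2 * (‖a p.1‖ * ‖a p.2‖ + ‖⟪a p.1, a p.2⟫_ℂ‖) ^ 2 -
        1 / 2 * (‖a p.1‖ ^ 2 * ‖a p.2‖ ^ 2) - 3 / 2 * ‖⟪a p.1, a p.2⟫_ℂ‖ ^ 2 := by
    ring
  have hsum : ∑ p : ι × ι,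
      ‖⟪a p.1, a p.2⟫_ℂ‖ * (‖a p.1‖ * ‖a p.2‖ - ‖⟪a p.1, a p.2⟫_ℂ‖) = 0 := by
    simp only [hterm, Finset.sum_sub_distrib, ← Finset.mul_sum, hnorm, hinner, hadd]
    push_cast
    ring
  have hzero := (Finset.sum_eq_zero_iff_of_nonneg fun p _ => mul_nonneg (norm_nonneg _)
    (sub_nonneg.mpr (norm_inner_le_norm (a p.1) (a p.2)))).mp hsum (i, j) (Finset.mem_univ _)
  exact (mul_eq_zero.mp hzero).imp_right fun h => (sub_eq_zero.mp h).symm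

theorem isRankOneProjective_of_estimationFidelity_eq {d : ℕ} [NeZero d] {ι : Type*} [Fintype ι]
    {A : POVM (Fin d) ι} {a : ι → EuclideanSpace ℂ (Fin d)} (hA : A.IsSimple)
    (ha : ∀ j, A.elem j = ketbra (a j))
    (h : estimationFidelity (A.tensor A) = 2 / ((d : ℝ) + 1)) : A.IsRankOneProjective :=
  POVM.isRankOneProjective_of_orthogonal ha
    (fun j hj => hA.elem_ne_zero j (by rw [ha, hj, ketbra_zero]))
    fun i j hij => norm_eq_zero.mp
      ((norm_inner_eq_zero_or_eq_of_estimationFidelity_eq ha h i j).resolve_right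
        (hA.norm_inner_ne ha hij))

/-! ### Fidelities of rank-one projective measurements -/

section RankOneProjective

variable {d : ℕ} {ι κ : Type*} [Fintype ι] [Fintype κ] {A : POVM (Fin d) ι} {B : POVM (Fin d) κ}

theorem POVM.IsRankOneProjective.exists_ketbra (hA : A.IsRankOneProjective) :
    ∃ a : ι → EuclideanSpace ℂ (Fin d), Orthonormal ℂ a ∧ (∀ j, A.elem j = ketbra (a j)) ∧
      Fintype.card ι = d := by
  choose a hnorm ha using fun j => exists_eq_ketbra_of_isStarProjection (hA.1 j).1 (hA.1 j).2
  refine ⟨a, ⟨hnorm, fun i j hij => ?_⟩, ha, ?_⟩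
  · have horth := congrArg trace (hA.2 i j hij)
    rw [ha, ha, trace_ketbra_mul_ketbra, trace_zero] at horth
    simpa using horth
  · have hcard := A.sum_trace
    simp only [ha, trace_ketbra, hnorm, one_pow, Complex.ofReal_one, Finset.sum_const,
      Finset.card_univ, nsmul_one, Fintype.card_fin] at hcard
    exact_mod_cast hcard

theorem estimationFidelity_tensor_self [NeZero d] (hA : A.IsRankOneProjective) :
    estimationFidelity (A.tensor A) = 2 / ((d : ℝ) + 1) := by
  classical
  have hd : (0 : ℝ) < d := Nat.cast_pos.mpr (NeZero.pos d)
  obtain ⟨a, hon, ha, hcard⟩ := hA.exists_ketbra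
  have hterm (p : ι × ι) : (‖a p.1‖ * ‖a p.2‖ + ‖⟪a p.1, a p.2⟫_ℂ‖) ^ 2 =
      1 + if p.1 = p.2 then 3 else 0 := by
    rw [hon.1, hon.1, orthonormal_iff_ite.mp hon]
    split_ifs <;> norm_num
  rw [estimationFidelity_tensor_ketbra ha ha]
  simp only [hterm, Fintype.sum_prod_type, Finset.sum_add_distrib, Finset.sum_ite_eq,
    Finset.mem_univ, if_true, Finset.sum_const, Finset.card_univ, Fintype.card_prod, hcard,
    nsmul_eq_mul, mul_one]
  push_cast
  field_simp
  ring

theorem POVM.IsMutuallyUnbiased.norm_inner_eq (h : A.IsMutuallyUnbiased B)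
    {a : ι → EuclideanSpace ℂ (Fin d)} {b : κ → EuclideanSpace ℂ (Fin d)}
    (ha : ∀ j, A.elem j = ketbra (a j)) (hb : ∀ k, B.elem k = ketbra (b k)) (j : ι) (k : κ) :
    ‖⟪a j, b k⟫_ℂ‖ = (√(d : ℝ))⁻¹ * (‖a j‖ * ‖b k‖) := by
  have hjk := h j k
  rw [ha, hb, trace_ketbra_mul_ketbra, trace_ketbra, trace_ketbra, Fintype.card_fin] at hjk
  norm_cast at hjk
  rw [← Real.sqrt_sq (norm_nonneg ⟪a j, b k⟫_ℂ), hjk, Real.sqrt_div' _ (Nat.cast_nonneg d),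
    ← mul_pow, Real.sqrt_sq (by positivity), div_eq_inv_mul]

theorem estimationFidelity_tensor_of_isMutuallyUnbiased [NeZero d] (hA : A.IsRankOneProjective)
    (hB : B.IsRankOneProjective) (h : A.IsMutuallyUnbiased B) :
    estimationFidelity (A.tensor B) = fidelitySep d := by
  have hd : (0 : ℝ) < d := Nat.cast_pos.mpr (NeZero.pos d)
  obtain ⟨a, hona, ha, hcarda⟩ := hA.exists_ketbra
  obtain ⟨b, honb, hb, hcardb⟩ := hB.exists_ketbra
  have hsum : ∑ p : ι × κ, (‖a p.1‖ * ‖b p.2‖ + ‖⟪a p.1, b p.2⟫_ℂ‖) ^ 2 =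
      (d : ℝ) * (√(d : ℝ) + 1) ^ 2 := by
    simp only [h.norm_inner_eq ha hb, hona.1, honb.1, Finset.sum_const, Finset.card_univ,
      Fintype.card_prod, hcarda, hcardb, nsmul_eq_mul]
    push_cast
    field_simp
    rw [Real.sq_sqrt hd.le]
  rw [estimationFidelity_tensor_ketbra ha hb, hsum, fidelitySep,
    div_eq_div_iff (by positivity) (by positivity)]
  linear_combination (d : ℝ) * (d + 1) * (d + 2) * Real.sq_sqrt hd.le

theorem isMutuallyUnbiased_of_norm_inner {a : ι → EuclideanSpace ℂ (Fin d)}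
    {b : κ → EuclideanSpace ℂ (Fin d)} (ha : ∀ j, A.elem j = ketbra (a j))
    (hb : ∀ k, B.elem k = ketbra (b k))
    (h : ∀ j k, ‖⟪a j, b k⟫_ℂ‖ = (√(d : ℝ))⁻¹ * (‖a j‖ * ‖b k‖)) : A.IsMutuallyUnbiased B := by
  intro j k
  rw [ha, hb, trace_ketbra_mul_ketbra, trace_ketbra, trace_ketbra, h, mul_pow, inv_pow,
    Real.sq_sqrt (Nat.cast_nonneg d), Fintype.card_fin]
  push_cast
  ring

end RankOneProjective

theorem corollary8 (d : ℕ) [NeZero d] {ι κ : Type*} [Fintype ι] [Fintype κ]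
    (A : POVM (Fin d) ι) (B : POVM (Fin d) κ) (hA : A.IsSimple) (hB : B.IsSimple) :
    (A.IsRankOneProjective ∧ B.IsRankOneProjective ∧ A.IsMutuallyUnbiased B) ↔
      (estimationFidelity (A.tensor B) = fidelitySep d ∧
        estimationFidelity (A.tensor A) = 2 / ((d : ℝ) + 1) ∧
        estimationFidelity (B.tensor B) = 2 / ((d : ℝ) + 1)) := by
  constructor
  · rintro ⟨projA, projB, unbiased⟩
    exact ⟨estimationFidelity_tensor_of_isMutuallyUnbiased projA projB unbiased,
      estimationFidelity_tensor_self projA, estimationFidelity_tensor_self projB⟩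
  · rintro ⟨fidAB, fidAA, fidBB⟩
    obtain ⟨a, b, ha, hb, hab⟩ := exists_ketbra_of_estimationFidelity_eq fidAB
    exact ⟨isRankOneProjective_of_estimationFidelity_eq hA ha fidAA,
      isRankOneProjective_of_estimationFidelity_eq hB hb fidBB,
      isMutuallyUnbiased_of_norm_inner ha hb hab⟩
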